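/- Let $d\ge 4$ and let $B=(B_s)_{s\ge 0}$ be a standard Brownian motion in $\mathbb{R}^d$ started at the origin, with law $P$ and expectation $E$. For $t\ge 0$ and $r>0$ let $$W_{[0,t]}^{0,r}=\bigcup_{0\le s\le t}\mathcal B(B_s,r),$$ where $\mathcal B(z,\rho)$ is the open Euclidean ball with centre $z$ and radius $\rho$. Let $G(x,y)=\frac{\Gamma(d/2-1)}{2\pi^{d/2}\,\|x-y\|^{d-2}}$ (with $G(x,x)=\infty$), and for a Borel set $A\subseteq\mathbb{R}^d$ let $$\mathrm{cap}(A)=\Big[\inf_{\nu}\int_A\int_A G(x,y)\,\nu(dx)\,\nu(dy)\Big]^{-1},$$ the infimum being over all Borel probability measures $\nu$ on $A$. For $b>0$ let $\mathcal A_t(b,r)=\{W_{[0,t]}^{0,r}\subseteq\mathcal B(0,b\sqrt t)\}$. (i) If $d\ge 5$, there is a constant $c=c(d)>0$ such that for all $b>0$, $t\ge 1$ and $r\in(0,1)$, $$E\big[\mathrm{cap}(W_{[0,t]}^{0,r})\,\mathbf 1_{\mathcal A_t(b,r)}\big]\ \ge\ c\,P(\mathcal A_t(b,r))^2\; t\,r^{d-4}.$$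 (ii) If $d=4$, then for every $s_0>1$ there is a constant $c=c(s_0)>0$ such that for all $b>0$, $t\ge 1$ and $r\in(0,1)$ with $t r^{-2}\ge s_0$, $$E\big[\mathrm{cap}(W_{[0,t]}^{0,r})\,\mathbf 1_{\mathcal A_t(b,r)}\big]\ \ge\ c\,P(\mathcal A_t(b,r))^2\;\frac{t}{\log(t r^{-2})}.$$ -/

import Mathlib

open MeasureTheory ProbabilityTheory
open scoped ENNReal NNReal

namespace WienerSausage

/-- `B` is a standard Brownian motion in `ℝ^d` started at the origin: its coordinates are
independent standard real Brownian motions (each one starting at `0` almost surely and having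
almost surely continuous paths). -/
structure IsBrownianMotion {d : ℕ} {Ω : Type*} [MeasurableSpace Ω]
    (B : ℝ≥0 → Ω → EuclideanSpace ℝ (Fin d)) (P : Measure Ω) : Prop where
  coord : ∀ i : Fin d, IsBrownianReal (fun s ω => B s ω i) P
  indep : iIndepFun (fun (i : Fin d) (ω : Ω) (s : ℝ≥0) => B s ω i) P

/-- The Green function of standard Brownian motion on `ℝ^d`, `d ≥ 3`, namely
`Γ(d/2 - 1) / (2 π^(d/2) ‖x - y‖^(d-2))`, with the value `∞` on the diagonal. -/
noncomputable def green {d : ℕ} (x y : EuclideanSpace ℝ (Fin d)) : ℝ≥0∞ :=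
  ENNReal.ofReal (Real.Gamma ((d : ℝ) / 2 - 1) / (2 * Real.pi ^ ((d : ℝ) / 2))) /
    edist x y ^ (d - 2)

/-- The energy of a Borel measure. -/
noncomputable def energy {d : ℕ} (ν : Measure (EuclideanSpace ℝ (Fin d))) : ℝ≥0∞ :=
  ∫⁻ x, ∫⁻ y, green x y ∂ν ∂ν

/-- The Newtonian capacity of `A`: the inverse of the infimum of the energy over all Borel
probability measures carried by `A`. -/
noncomputable def cap {d : ℕ} (A : Set (EuclideanSpace ℝ (Fin d))) : ℝ≥0∞ :=
  (⨅ (ν : Measure (EuclideanSpace ℝ (Fin d))) (_ : IsProbabilityMeasure ν) (_ : ν Aᶜ = 0),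
    energy ν)⁻¹

/-- The sausage of radius `r` around the path of `B` up to time `t`: the union over
`0 ≤ s ≤ t` of the open balls of radius `r` centred at `B s`. -/
def sausage {d : ℕ} {Ω : Type*} (B : ℝ≥0 → Ω → EuclideanSpace ℝ (Fin d))
    (r : ℝ) (t : ℝ≥0) (ω : Ω) : Set (EuclideanSpace ℝ (Fin d)) :=
  ⋃ s ∈ Set.Icc 0 t, Metric.ball (B s ω) r

/-- The event that the sausage up to time `t` stays inside the open ball of radius `b √t`
centred at the origin. -/
def confined {d : ℕ} {Ω : Type*} (B : ℝ≥0 → Ω → EuclideanSpace ℝ (Fin d))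
    (b r : ℝ) (t : ℝ≥0) : Set Ω :=
  {ω | sausage B r t ω ⊆ Metric.ball 0 (b * √(t : ℝ))}

/-- The expectation `E[cap(W); A]` of the capacity of the sausage on the confinement event. -/
noncomputable def confinedMeanCap {d : ℕ} {Ω : Type*} [MeasurableSpace Ω]
    (B : ℝ≥0 → Ω → EuclideanSpace ℝ (Fin d)) (P : Measure Ω) (b r : ℝ) (t : ℝ≥0) : ℝ≥0∞ :=
  ∫⁻ ω, (confined B b r t).indicator (fun ω => cap (sausage B r t ω)) ω ∂P

end WienerSausage

/-! The capacity is at least the inverse energy of any probability measure carried by the sausage.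
The test measure is the law of `B s + q`, with `s` uniform on `[0, t]` and `q` uniform on a cube
inside the ball of radius `r`. The smoothing by `q` is essential: for `d ≥ 4` the mean energy of the
raw occupation measure diverges on the diagonal. Writing `e` for the random energy and `A` for the
confinement event, Cauchy–Schwarz gives `E[e⁻¹; A] ≥ P(A)² / E[e]` (`sq_measure_div_le`). This is
the source of the square, and it leaves only an upper bound for the unrestricted mean energy.

For that bound, a random vector with independent coordinates of density at most `M` has mean Green
function at most a constant times `M ^ (d - 2)`, uniformly in the pole (`lintegral_green_le`). With
`M = |s - u| ^ (-1/2)` this applies to a Brownian increment, and with `M = d / r` to the smoothing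
cube. Using the cube when `|s - u| ≤ r ^ 2` and the increment otherwise, the mean energy is at most
of order `t⁻¹ (r ^ (4 - d) + ∫ v ^ (1 - d / 2) dv)`, the integral running over `r ^ 2 < v ≤ t`. This
is of order `t⁻¹ r ^ (4 - d)` for `d ≥ 5` and `t⁻¹ (1 + log (t / r ^ 2))` for `d = 4`. -/

namespace WienerSausage

/-! ### Mean Green function of vectors with independent coordinates of bounded density -/

theorem lintegral_ball_edist_rpow_neg {a δ : ℝ} (ha : a < 1) (hδ : 0 ≤ δ) (y : ℝ) :
    ∫⁻ x in Metric.ball y δ, edist x y ^ (-a) ≤ ENNReal.ofReal (2 * (δ ^ (1 - a) / (1 - a))) := by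
  have hint : ∀ u v : ℝ, IntervalIntegrable (fun x : ℝ => x ^ (-a)) volume u v := fun u v =>
    intervalIntegral.intervalIntegrable_rpow' (by linarith)
  have hpos : ∫⁻ x in Set.Ioc 0 δ, edist x 0 ^ (-a)
      = ENNReal.ofReal (δ ^ (1 - a) / (1 - a)) := by
    have h1 := integral_rpow (a := 0) (b := δ) (r := -a) (Or.inl (by linarith))
    rw [Real.zero_rpow (by linarith), sub_zero, show -a + 1 = 1 - a by ring] at h1
    rw [← h1, intervalIntegral.integral_of_le hδ, ofReal_integral_eq_lintegral_ofReal]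
    · refine setLIntegral_congr_fun measurableSet_Ioc fun x hx => ?_
      simp only [edist_dist, Real.dist_eq, sub_zero, abs_of_pos hx.1]
      rw [ENNReal.ofReal_rpow_of_pos hx.1]
    · exact (hint 0 δ).1
    · exact (ae_restrict_mem measurableSet_Ioc).mono fun x hx => Real.rpow_nonneg hx.1.le _
  have hneg : ∫⁻ x in Set.Ico (-δ) 0, edist x 0 ^ (-a)
      = ENNReal.ofReal (δ ^ (1 - a) / (1 - a)) := by
    rw [← hpos, ← (Measure.measurePreserving_neg (volume : Measure ℝ)).setLIntegral_comp_preimage_emb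
      (MeasurableEquiv.neg ℝ).measurableEmbedding]
    simp [edist_dist]
  have htrans : ∫⁻ x in Metric.ball y δ, edist x y ^ (-a)
      = ∫⁻ x in Metric.ball (0 : ℝ) δ, edist x 0 ^ (-a) := by
    symm
    rw [← (measurePreserving_sub_right (volume : Measure ℝ) y).setLIntegral_comp_preimage_emb
      (MeasurableEquiv.subRight y).measurableEmbedding]
    congr 1
    · congr 1
      ext x
      simp [Real.dist_eq]
    · ext x
      simp [edist_dist, Real.dist_eq]
  rw [htrans, two_mul, ENNReal.ofReal_add (by have := Real.rpow_nonneg hδ (1 - a); bound)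
    (by have := Real.rpow_nonneg hδ (1 - a); bound)]
  nth_rewrite 1 [← hneg]
  rw [← hpos]
  refine le_trans ?_ (add_le_add_right (lintegral_mono_set' (s := Set.Icc 0 δ) ?_) _)
  · refine (lintegral_mono_set ?_).trans (lintegral_union_le _ _ _)
    intro x hx
    simp only [Metric.mem_ball, Real.dist_eq, sub_zero, abs_lt] at hx
    rcases lt_or_ge x 0 with h | h
    · exact Or.inl ⟨hx.1.le, h⟩
    · exact Or.inr ⟨h, hx.2.le⟩
  · exact Ioc_ae_eq_Icc.symm.le

/-- The cut is at distance `M⁻¹` from the pole: inside, the density bound reduces to Lebesgue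
measure; outside, the integrand is at most `M ^ a` and the mass at most one. Both parts scale as `M
^ a`. -/
theorem lintegral_edist_rpow_neg_le {μ : Measure ℝ} [IsProbabilityMeasure μ] {M a : ℝ}
    (hM : 0 < M) (ha0 : 0 ≤ a) (ha : a < 1) (hμ : μ ≤ ENNReal.ofReal M • volume) (y : ℝ) :
    ∫⁻ x, edist x y ^ (-a) ∂μ ≤ ENNReal.ofReal ((2 / (1 - a) + 1) * M ^ a) := by
  have h1a : 0 < 1 - a := by linarith
  rw [← lintegral_add_compl _ (measurableSet_ball (x := y) (ε := M⁻¹)), add_mul,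
    ENNReal.ofReal_add (by positivity) (by positivity), one_mul]
  refine add_le_add ?_ ?_
  · calc ∫⁻ x in Metric.ball y M⁻¹, edist x y ^ (-a) ∂μ
        ≤ ∫⁻ x in Metric.ball y M⁻¹, edist x y ^ (-a) ∂(ENNReal.ofReal M • volume) :=
          lintegral_mono' (Measure.restrict_mono le_rfl hμ) le_rfl
      _ ≤ ENNReal.ofReal M * ENNReal.ofReal (2 * (M⁻¹ ^ (1 - a) / (1 - a))) := by
          rw [Measure.restrict_smul, lintegral_smul_measure]
          exact mul_le_mul_right (lintegral_ball_edist_rpow_neg ha (by positivity) y) _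
      _ = ENNReal.ofReal (2 / (1 - a) * M ^ a) := by
          rw [← ENNReal.ofReal_mul hM.le]
          congr 1
          rw [Real.inv_rpow hM.le, ← Real.rpow_neg hM.le, show -(1 - a) = a - 1 by ring,
            Real.rpow_sub_one hM.ne']
          field_simp
  · calc ∫⁻ x in (Metric.ball y M⁻¹)ᶜ, edist x y ^ (-a) ∂μ
        ≤ ∫⁻ x in (Metric.ball y M⁻¹)ᶜ, ENNReal.ofReal (M ^ a) ∂μ := by
          refine setLIntegral_mono measurable_const fun x hx => ?_
          have hx' : M⁻¹ ≤ dist x y := by simpa using hx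
          rw [edist_dist, ENNReal.ofReal_rpow_of_pos ((inv_pos.2 hM).trans_le hx')]
          refine ENNReal.ofReal_le_ofReal ?_
          rw [← inv_inv M, Real.inv_rpow (by positivity), ← Real.rpow_neg (by positivity)]
          exact Real.rpow_le_rpow_of_nonpos (by positivity) hx' (by linarith)
      _ ≤ ENNReal.ofReal (M ^ a) := by
          rw [lintegral_const, Measure.restrict_apply_univ]
          exact mul_le_of_le_one_right' prob_le_one

theorem edist_apply_le {d : ℕ} (x y : EuclideanSpace ℝ (Fin d)) (i : Fin d) :
    edist (x i) (y i) ≤ edist x y := by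
  rw [edist_dist, edist_dist, dist_eq_norm, dist_eq_norm]
  exact ENNReal.ofReal_le_ofReal (PiLp.norm_apply_le (x - y) i)

/-- Each coordinate distance is at most the Euclidean one, so the exponent `d - 2` can be shared
equally among the `d` coordinates. Each share `(d - 2) / d` is below one, hence locally integrable
on the line. -/
theorem inv_edist_pow_le_prod {d : ℕ} (hd : 2 ≤ d) (x y : EuclideanSpace ℝ (Fin d)) :
    (edist x y ^ (d - 2))⁻¹ ≤ ∏ i, edist (x i) (y i) ^ (-(((d : ℝ) - 2) / d)) := by
  have hd' : (2 : ℝ) ≤ d := by exact_mod_cast hd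
  calc (edist x y ^ (d - 2))⁻¹ = ∏ _i : Fin d, edist x y ^ (-(((d : ℝ) - 2) / d)) := by
        rw [Finset.prod_const, Finset.card_univ, Fintype.card_fin, ← ENNReal.rpow_natCast,
          ← ENNReal.rpow_natCast, ← ENNReal.rpow_neg, ← ENNReal.rpow_mul]
        congr 1
        push_cast [hd]
        field_simp
    _ ≤ _ := Finset.prod_le_prod' fun i _ => by
        rw [ENNReal.rpow_neg, ENNReal.rpow_neg]
        exact ENNReal.inv_le_inv.2 (ENNReal.rpow_le_rpow (edist_apply_le x y i) (by
          have : 0 ≤ (d : ℝ) - 2 := by linarith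
          positivity))

/-- The multiplicative constant in `green`. -/
noncomputable def greenConst (d : ℕ) : ℝ :=
  Real.Gamma ((d : ℝ) / 2 - 1) / (2 * Real.pi ^ ((d : ℝ) / 2))

/-- The constant in the bound for the mean Green function of a random vector with independent
coordinates of bounded density. -/
noncomputable def meanGreenConst (d : ℕ) : ℝ :=
  greenConst d * (2 / (1 - ((d : ℝ) - 2) / d) + 1) ^ d

theorem greenConst_pos {d : ℕ} (hd : 3 ≤ d) : 0 < greenConst d := by
  have hd' : (3 : ℝ) ≤ d := by exact_mod_cast hd
  have := Real.Gamma_pos_of_pos (show 0 < (d : ℝ) / 2 - 1 by linarith)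
  have := Real.pi_pos
  unfold greenConst
  positivity

theorem exponent_lt_one {d : ℕ} (hd : 3 ≤ d) : ((d : ℝ) - 2) / d < 1 := by
  have hd' : (3 : ℝ) ≤ d := by exact_mod_cast hd
  rw [div_lt_one (by linarith)]
  linarith

theorem meanGreenConst_pos {d : ℕ} (hd : 3 ≤ d) : 0 < meanGreenConst d := by
  have := greenConst_pos hd
  have : 0 < 1 - ((d : ℝ) - 2) / d := by linarith [exponent_lt_one hd]
  unfold meanGreenConst
  positivity

/-- Independence factorises the coordinatewise product bound; the `d` factors `M ^ ((d - 2) / d)`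
multiply to `M ^ (d - 2)`. -/
theorem lintegral_green_le {d : ℕ} (hd : 3 ≤ d) {Ω : Type*} [MeasurableSpace Ω] {P : Measure Ω}
    [IsProbabilityMeasure P] {X : Ω → EuclideanSpace ℝ (Fin d)}
    (hX : ∀ i, Measurable fun ω => X ω i) (hind : iIndepFun (fun i ω => X ω i) P)
    {M : ℝ} (hM : 0 < M) (hlaw : ∀ i, P.map (fun ω => X ω i) ≤ ENNReal.ofReal M • volume)
    (y : EuclideanSpace ℝ (Fin d)) :
    ∫⁻ ω, green (X ω) y ∂P ≤ ENNReal.ofReal (meanGreenConst d * M ^ (d - 2)) := by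
  have hd' : (3 : ℝ) ≤ d := by exact_mod_cast hd
  set a : ℝ := ((d : ℝ) - 2) / d with ha
  have ha0 : 0 ≤ a := div_nonneg (by linarith) (by linarith)
  have ha1 : a < 1 := exponent_lt_one hd
  have hC : 0 < 2 / (1 - a) + 1 := by
    have : 0 < 1 - a := by linarith
    positivity
  have hmeas : ∀ i, Measurable fun x : ℝ => edist x (y i) ^ (-a) := fun i =>
    (measurable_id.edist measurable_const).pow_const _
  calc ∫⁻ ω, green (X ω) y ∂P
      ≤ ∫⁻ ω, ENNReal.ofReal (greenConst d) * ∏ i, edist (X ω i) (y i) ^ (-a) ∂P := by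
        refine lintegral_mono fun ω => ?_
        simp only [green]
        rw [div_eq_mul_inv]
        exact mul_le_mul_right (inv_edist_pow_le_prod (by omega) _ _) _
    _ = ENNReal.ofReal (greenConst d) * ∏ i, ∫⁻ ω, edist (X ω i) (y i) ^ (-a) ∂P := by
        rw [lintegral_const_mul' _ _ ENNReal.ofReal_ne_top]
        congr 1
        exact lintegral_prod_eq_prod_lintegral_of_indepFun Finset.univ _
          (hind.comp (fun i x => edist x (y i) ^ (-a)) hmeas) fun i => (hmeas i).comp (hX i)
    _ ≤ ENNReal.ofReal (greenConst d) * ∏ _i : Fin d, ENNReal.ofReal ((2 / (1 - a) + 1) * M ^ a) := by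
        refine mul_le_mul_right (Finset.prod_le_prod' fun i _ => ?_) _
        have := Measure.isProbabilityMeasure_map (μ := P) (hX i).aemeasurable
        rw [← lintegral_map (hmeas i) (hX i)]
        exact lintegral_edist_rpow_neg_le hM ha0 ha1 (hlaw i) _
    _ = ENNReal.ofReal (meanGreenConst d * M ^ (d - 2)) := by
        rw [Finset.prod_const, Finset.card_univ, Fintype.card_fin,
          ← ENNReal.ofReal_pow (by positivity), ← ENNReal.ofReal_mul (greenConst_pos hd).le,
          meanGreenConst, mul_pow, mul_assoc, ← ha]
        congr 3
        rw [← Real.rpow_natCast, ← Real.rpow_mul hM.le, ← Real.rpow_natCast]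
        congr 1
        rw [ha, Nat.cast_sub (by omega)]
        push_cast
        field_simp

/-! ### Time integrals of the truncated kernel, with `n = d - 2` -/

theorem lintegral_bound_integral {n : ℕ} {r t : ℝ} (hr : 0 < r) {I : ℝ} (hI : 0 ≤ I)
    (hlog : n = 2 → r ^ 2 ≤ t ∧ I = Real.log (t / r ^ 2)) (hpow : n ≠ 2 → 3 ≤ n ∧ I = 2 / r ^ (n - 2)) :
    ∫⁻ v in Set.Icc 0 t, ENNReal.ofReal (if v ≤ r ^ 2 then (r⁻¹) ^ n else ((√v)⁻¹) ^ n) ≤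
      ENNReal.ofReal (r ^ 2 * r⁻¹ ^ n + I) := by
  have hr2 : 0 < r ^ 2 := by positivity
  have hsqrt : ∀ v : ℝ, 0 < v → ((√v)⁻¹) ^ n = v ^ (-((n : ℝ) / 2)) := fun v hv => by
    rw [Real.sqrt_eq_rpow, ← Real.rpow_neg hv.le, ← Real.rpow_natCast, ← Real.rpow_mul hv.le]
    congr 1
    ring
  have hsub : Set.Icc 0 t ⊆ Set.Icc 0 (r ^ 2) ∪ Set.Ioc (r ^ 2) t := by
    intro v hv
    rcases le_or_gt v (r ^ 2) with h | h
    · exact Or.inl ⟨hv.1, h⟩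
    · exact Or.inr ⟨h, hv.2⟩
  rw [ENNReal.ofReal_add (by positivity) hI]
  refine (lintegral_mono_set hsub).trans ((lintegral_union_le _ _ _).trans (add_le_add ?_ ?_))
  · rw [setLIntegral_congr_fun (g := fun _ => ENNReal.ofReal ((r⁻¹) ^ n)) measurableSet_Icc
      fun v hv => by simp [hv.2], setLIntegral_const, Real.volume_Icc, sub_zero,
      ← ENNReal.ofReal_mul (by positivity), mul_comm]
  · rw [setLIntegral_congr_fun (g := fun v => ENNReal.ofReal (v ^ (-((n : ℝ) / 2))))
      measurableSet_Ioc fun v hv => by simp [not_le.2 hv.1, ← hsqrt v (hr2.trans hv.1)]]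
    have hnn : ∀ s : Set ℝ, s ⊆ Set.Ioi (r ^ 2) → MeasurableSet s →
        0 ≤ᵐ[volume.restrict s] fun v : ℝ => v ^ (-((n : ℝ) / 2)) := fun s hs hms =>
      (ae_restrict_mem hms).mono fun v hv => Real.rpow_nonneg (hr2.trans (hs hv)).le _
    by_cases hn : n = 2
    · obtain ⟨hrt, rfl⟩ := hlog hn
      subst hn
      rw [← integral_inv_of_pos hr2 (hr2.trans_le hrt), intervalIntegral.integral_of_le hrt,
        ofReal_integral_eq_lintegral_ofReal]
      · refine lintegral_mono fun v => ?_
        norm_num [Real.rpow_neg_one]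
      · refine (intervalIntegral.intervalIntegrable_inv (fun x hx => ?_) continuousOn_id).1
        rw [Set.uIcc_of_le hrt] at hx
        exact (hr2.trans_le hx.1).ne'
      · simpa [Real.rpow_neg_one] using hnn _ Set.Ioc_subset_Ioi_self measurableSet_Ioc
    · obtain ⟨hn3, rfl⟩ := hpow hn
      have hn3' : (3 : ℝ) ≤ n := by exact_mod_cast hn3
      have hlt : -((n : ℝ) / 2) < -1 := by linarith
      -- For `n ≥ 3` the tail up to infinity converges; dividing by `n / 2 - 1 ≥ 1 / 2` produces the
      -- factor `2` in `I`.
      refine (lintegral_mono_set Set.Ioc_subset_Ioi_self).trans ?_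
      rw [← ofReal_integral_eq_lintegral_ofReal (integrableOn_Ioi_rpow_of_lt hlt hr2)
        (hnn _ le_rfl measurableSet_Ioi), integral_Ioi_rpow_of_lt hlt hr2]
      refine ENNReal.ofReal_le_ofReal ?_
      have h1 : (r ^ 2) ^ (-((n : ℝ) / 2) + 1) = (r ^ (n - 2))⁻¹ := by
        rw [← Real.rpow_natCast, ← Real.rpow_mul hr.le, ← Real.rpow_natCast,
          ← Real.rpow_neg hr.le, Nat.cast_sub (by omega)]
        congr 1
        push_cast
        ring
      have hX : 0 ≤ (r ^ (n - 2))⁻¹ := by positivity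
      rw [h1, div_le_iff_of_neg (by linarith), div_eq_mul_inv 2]
      nlinarith [mul_nonneg hX (sub_nonneg.2 hn3')]

/-- Cutting at `s` and translating or reflecting, each side becomes an integral over a subinterval
of `[0, t]` starting at `0`. -/
theorem lintegral_Icc_abs_sub_le {t : ℝ} {h : ℝ → ℝ≥0∞} (s : ℝ) (hs : s ∈ Set.Icc 0 t) :
    ∫⁻ u in Set.Icc 0 t, h |s - u| ≤ 2 * ∫⁻ v in Set.Icc 0 t, h v := by
  have hsub : Set.Icc 0 t ⊆ Set.Icc 0 s ∪ Set.Icc s t := by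
    intro u hu
    rcases le_total u s with h | h
    · exact Or.inl ⟨hu.1, h⟩
    · exact Or.inr ⟨h, hu.2⟩
  refine (lintegral_mono_set hsub).trans ((lintegral_union_le _ _ _).trans ?_)
  rw [two_mul]
  refine add_le_add ?_ ?_
  · rw [setLIntegral_congr_fun (g := fun u => h (s - u)) measurableSet_Icc fun u hu => by
      simp [abs_of_nonneg (sub_nonneg.2 hu.2)]]
    have := (Measure.measurePreserving_sub_left (volume : Measure ℝ) s).setLIntegral_comp_preimage_emb
      (MeasurableEquiv.subLeft s).measurableEmbedding h (Set.Icc 0 s)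
    rw [show (fun u => s - u) ⁻¹' Set.Icc 0 s = Set.Icc 0 s by simp] at this
    rw [this]
    exact lintegral_mono_set (Set.Icc_subset_Icc_right hs.2)
  · rw [setLIntegral_congr_fun (g := fun u => h (u - s)) measurableSet_Icc fun u hu => by
      simp [abs_sub_comm s u, abs_of_nonneg (sub_nonneg.2 hu.1)]]
    have := (measurePreserving_sub_right (volume : Measure ℝ) s).setLIntegral_comp_preimage_emb
      (MeasurableEquiv.subRight s).measurableEmbedding h (Set.Icc 0 (t - s))
    rw [show (fun u => u - s) ⁻¹' Set.Icc 0 (t - s) = Set.Icc s t by simp] at this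
    rw [this]
    exact lintegral_mono_set (Set.Icc_subset_Icc_right (by linarith [hs.1]))

/-! ### Cauchy–Schwarz for the inverse energy, and geometry of the confinement -/

theorem sq_measure_div_le {Ω : Type*} [MeasurableSpace Ω] {P : Measure Ω} [IsFiniteMeasure P]
    (A : Set Ω) {e : Ω → ℝ≥0∞} (he : Measurable e) {C : ℝ}
    (hC : 0 < C) (heC : ∫⁻ ω, e ω ∂P ≤ ENNReal.ofReal C) :
    ENNReal.ofReal C⁻¹ * P A ^ 2 ≤ ∫⁻ ω in A, (e ω)⁻¹ ∂P := by
  set p : ℝ := (P A).toReal with hp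
  have hp0 : 0 ≤ p := ENNReal.toReal_nonneg
  have hPA : P A = ENNReal.ofReal p := (ENNReal.ofReal_toReal (measure_ne_top P A)).symm
  -- This value maximises `2 * l * p - l ^ 2 * C`, the lower bound obtained by integrating `key`
  -- over `A`; the maximum is `p ^ 2 / C`.
  set l : ℝ := p / C with hl
  have hl0 : 0 ≤ l := by positivity
  -- For `l > 0`, the tangent line of `x⁻¹` at `x = l⁻¹`. This linear form of Cauchy–Schwarz stays
  -- valid when the energy is `0` or `∞`.
  have key : ∀ x : ℝ≥0∞, ENNReal.ofReal (2 * l) ≤ x⁻¹ + ENNReal.ofReal (l ^ 2) * x := by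
    intro x
    rcases hl0.eq_or_lt with h | h
    · simp [← h]
    rcases eq_or_ne x 0 with rfl | hx0
    · simp
    rcases eq_or_ne x ⊤ with rfl | hxt
    · rw [ENNReal.mul_top (by simpa using by positivity)]
      simp
    have hx : 0 < x.toReal := ENNReal.toReal_pos hx0 hxt
    rw [← ENNReal.ofReal_toReal hxt, ← ENNReal.ofReal_inv_of_pos hx,
      ← ENNReal.ofReal_mul (by positivity), ← ENNReal.ofReal_add (by positivity) (by positivity)]
    refine ENNReal.ofReal_le_ofReal ?_
    have : x.toReal⁻¹ + l ^ 2 * x.toReal - 2 * l = x.toReal⁻¹ * (1 - l * x.toReal) ^ 2 := by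
      field_simp
      ring
    have : 0 ≤ x.toReal⁻¹ * (1 - l * x.toReal) ^ 2 := by positivity
    linarith
  have h1 : ENNReal.ofReal (2 * l) * P A ≤
      ∫⁻ ω in A, (e ω)⁻¹ ∂P + ENNReal.ofReal (l ^ 2) * ENNReal.ofReal C := by
    calc ENNReal.ofReal (2 * l) * P A = ∫⁻ _ in A, ENNReal.ofReal (2 * l) ∂P := by
          rw [setLIntegral_const]
      _ ≤ ∫⁻ ω in A, ((e ω)⁻¹ + ENNReal.ofReal (l ^ 2) * e ω) ∂P := lintegral_mono fun ω => key _
      _ = ∫⁻ ω in A, (e ω)⁻¹ ∂P + ENNReal.ofReal (l ^ 2) * ∫⁻ ω in A, e ω ∂P := by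
          rw [lintegral_add_right _ (he.const_mul _), lintegral_const_mul _ he]
      _ ≤ _ := by
          gcongr
          exact (setLIntegral_le_lintegral _ _).trans heC
  rw [hPA, ← ENNReal.ofReal_mul (by positivity), ← ENNReal.ofReal_mul (by positivity)] at h1
  rw [hPA, ← ENNReal.ofReal_pow hp0, ← ENNReal.ofReal_mul (by positivity)]
  have h2 : 2 * l * p = C⁻¹ * p ^ 2 + l ^ 2 * C := by
    rw [hl]; field_simp; ring
  rw [h2, ENNReal.ofReal_add (by positivity) (by positivity)] at h1
  exact (ENNReal.add_le_add_iff_right ENNReal.ofReal_ne_top).1 h1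

/-- Points of the small ball pushed radially outwards from `x` have norms approaching `‖x‖ + r`; at
`x = 0` any direction serves. Confinement thus becomes a closed condition on the path. -/
theorem ball_subset_ball_zero_iff {E : Type*} [NormedAddCommGroup E] [NormedSpace ℝ E]
    [Nontrivial E] {x : E} {r R : ℝ} (hr : 0 < r) :
    Metric.ball x r ⊆ Metric.ball 0 R ↔ ‖x‖ + r ≤ R := by
  refine ⟨fun h => ?_, fun h => Metric.ball_subset_ball' (by rw [dist_zero_right]; linarith)⟩
  obtain ⟨e, he, hx⟩ : ∃ e : E, ‖e‖ = 1 ∧ x = ‖x‖ • e := by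
    rcases eq_or_ne x 0 with rfl | hx
    · obtain ⟨e, he⟩ := exists_norm_eq E zero_le_one
      exact ⟨e, he, by simp⟩
    · exact ⟨‖x‖⁻¹ • x, by simp [norm_smul, hx], by simp [smul_smul, hx]⟩
  rw [← le_sub_iff_add_le']
  refine le_of_forall_lt_imp_le_of_dense fun ρ hρ => ?_
  rcases le_or_gt ρ 0 with h0 | h0
  · have := h (Metric.mem_ball_self hr)
    rw [mem_ball_zero_iff] at this
    linarith
  · have hmem : (‖x‖ + ρ) • e ∈ Metric.ball x r := by
      rw [Metric.mem_ball, dist_eq_norm, add_smul, ← hx, add_sub_cancel_left, norm_smul, he,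
        mul_one, Real.norm_of_nonneg h0.le]
      exact hρ
    have := h hmem
    rw [mem_ball_zero_iff, norm_smul, he, mul_one, Real.norm_of_nonneg (by positivity)] at this
    linarith

/-! ### Density bounds for the Gaussian law and for the smoothing cube -/

theorem gaussianReal_le_smul_volume (m : ℝ) {v : ℝ≥0} (hv : v ≠ 0) :
    gaussianReal m v ≤ ENNReal.ofReal (√v)⁻¹ • volume := by
  rw [gaussianReal_of_var_ne_zero m hv, ← withDensity_const]
  refine withDensity_mono (ae_of_all _ fun x => ENNReal.ofReal_le_ofReal ?_)
  have hv' : (0 : ℝ) < v := by positivity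
  have h1 : Real.exp (-(x - m) ^ 2 / (2 * v)) ≤ 1 := by
    rw [Real.exp_le_one_iff]
    have : 0 ≤ (x - m) ^ 2 / (2 * v) := by positivity
    rw [neg_div]
    linarith
  rw [gaussianPDFReal]
  calc (√(2 * Real.pi * v))⁻¹ * Real.exp (-(x - m) ^ 2 / (2 * v)) ≤ (√(2 * Real.pi * v))⁻¹ * 1 := by
        gcongr
    _ ≤ (√v)⁻¹ := by
        rw [mul_one]
        have := Real.pi_gt_three
        gcongr
        nlinarith

/-- The uniform probability measure on the interval `[-ρ, ρ]`. -/
noncomputable def unifInterval (ρ : ℝ) : Measure ℝ :=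
  ENNReal.ofReal (2 * ρ)⁻¹ • volume.restrict (Set.Icc (-ρ) ρ)

theorem isProbabilityMeasure_unifInterval {ρ : ℝ} (hρ : 0 < ρ) :
    IsProbabilityMeasure (unifInterval ρ) := ⟨by
  rw [unifInterval, Measure.smul_apply, Measure.restrict_apply_univ, Real.volume_Icc, smul_eq_mul,
    ← ENNReal.ofReal_mul (by positivity), sub_neg_eq_add, ← two_mul,
    inv_mul_cancel₀ (by positivity), ENNReal.ofReal_one]⟩

/-- The uniform probability measure on the centred cube of side `2 ρ`. -/
noncomputable def unifCube (d : ℕ) (ρ : ℝ) : Measure (EuclideanSpace ℝ (Fin d)) :=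
  (Measure.pi fun _ : Fin d => unifInterval ρ).map (WithLp.toLp 2)

theorem measurable_toLp_fin (d : ℕ) :
    Measurable (WithLp.toLp 2 : (Fin d → ℝ) → EuclideanSpace ℝ (Fin d)) :=
  (MeasurableEquiv.toLp 2 (Fin d → ℝ)).measurable

theorem isProbabilityMeasure_unifCube {d : ℕ} {ρ : ℝ} (hρ : 0 < ρ) :
    IsProbabilityMeasure (unifCube d ρ) := by
  have := isProbabilityMeasure_unifInterval hρ
  exact Measure.isProbabilityMeasure_map (measurable_toLp_fin d).aemeasurable

/-- With half-side `r / d` the norm is at most `r / √d`, strictly below `r`. -/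
theorem ae_norm_lt_unifCube {d : ℕ} {r : ℝ} (hd : 2 ≤ d) (hr : 0 < r) :
    ∀ᵐ q ∂unifCube d (r / d), ‖q‖ < r := by
  have hd' : (2 : ℝ) ≤ d := by exact_mod_cast hd
  have hρ : 0 < r / d := by positivity
  have := isProbabilityMeasure_unifInterval hρ
  rw [unifCube, ae_map_iff (measurable_toLp_fin d).aemeasurable
    (measurableSet_lt measurable_norm measurable_const)]
  have h0 : ∀ᵐ x ∂(volume.restrict (Set.Icc (-(r / d)) (r / d))), |x| ≤ r / d :=
    (ae_restrict_mem measurableSet_Icc).mono fun x hx => abs_le.2 hx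
  have h1 : ∀ᵐ x ∂(unifInterval (r / d)), |x| ≤ r / d := Measure.ae_smul_measure h0 _
  have h2 : ∀ᵐ q ∂(Measure.pi fun _ : Fin d => unifInterval (r / d)), ∀ i, |q i| ≤ r / d :=
    ae_all_iff.2 fun i => (Measure.quasiMeasurePreserving_eval (fun _ : Fin d => unifInterval (r / d)) i).ae h1
  filter_upwards [h2] with q hq
  rw [EuclideanSpace.norm_eq, Real.sqrt_lt' hr]
  calc ∑ i, ‖(WithLp.toLp 2 q : EuclideanSpace ℝ (Fin d)) i‖ ^ 2
      ≤ ∑ _i : Fin d, (r / d) ^ 2 := Finset.sum_le_sum fun i _ =>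
        pow_le_pow_left₀ (norm_nonneg _) (hq i) 2
    _ = r ^ 2 / d := by
        rw [Finset.sum_const, Finset.card_univ, Fintype.card_fin, nsmul_eq_mul]
        field_simp
    _ < r ^ 2 := div_lt_self (by positivity) (by linarith)

/-- The coordinates are independent and uniform with density `d / (2 * r)`, here bounded by `d / r`.
-/
theorem lintegral_green_unifCube_le {d : ℕ} (hd : 3 ≤ d) {r : ℝ} (hr : 0 < r)
    (y : EuclideanSpace ℝ (Fin d)) :
    ∫⁻ q, green q y ∂(unifCube d (r / d)) ≤
      ENNReal.ofReal (meanGreenConst d * (d * r⁻¹) ^ (d - 2)) := by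
  have hd' : (3 : ℝ) ≤ d := by exact_mod_cast hd
  have hρ : 0 < r / d := by positivity
  have := isProbabilityMeasure_unifInterval hρ
  have := isProbabilityMeasure_unifCube (d := d) hρ
  have hcoord : ∀ i, Measurable fun q : EuclideanSpace ℝ (Fin d) => q i := fun i => by fun_prop
  have hmap : ∀ i, (unifCube d (r / d)).map (fun q => q i) = unifInterval (r / d) := fun i => by
    rw [unifCube, Measure.map_map (hcoord i) (measurable_toLp_fin d)]
    exact (measurePreserving_eval _ i).map_eq
  refine lintegral_green_le hd hcoord ?_ (by positivity) (fun i => ?_) y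
  · rw [iIndepFun_iff_map_fun_eq_pi_map fun i => (hcoord i).aemeasurable]
    simp_rw [hmap]
    rw [unifCube, Measure.map_map (measurable_pi_lambda _ hcoord) (measurable_toLp_fin d)]
    exact Measure.map_id
  · rw [hmap, unifInterval]
    refine (Measure.le_iff.2 fun s _ => ?_)
    simp only [Measure.smul_apply, smul_eq_mul]
    gcongr
    · rw [mul_inv, inv_div, div_eq_mul_inv]
      have : 0 < (d : ℝ) * r⁻¹ := by positivity
      linarith
    · exact Measure.restrict_le_self

/-! ### Brownian increments and a regular version of the motion -/

theorem measurable_green {d : ℕ} {α : Type*} [MeasurableSpace α]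
    {f g : α → EuclideanSpace ℝ (Fin d)} (hf : Measurable f) (hg : Measurable g) :
    Measurable fun x => green (f x) (g x) := by
  unfold green
  exact measurable_const.div ((hf.edist hg).pow_const _)

theorem green_add_add {d : ℕ} (a b p q : EuclideanSpace ℝ (Fin d)) :
    green (a + p) (b + q) = green (a - b) (q - p) := by
  simp only [green, edist_dist, dist_eq_norm]
  congr 4
  abel_nf

/-- The coordinates of the increment are independent centred Gaussians of variance `|s - u|`, with
density at most `|s - u| ^ (-1/2)`. -/
theorem IsBrownianMotion.lintegral_green_le {d : ℕ} (hd : 3 ≤ d) {Ω : Type*} [MeasurableSpace Ω]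
    {P : Measure Ω} [IsProbabilityMeasure P] {B B' : ℝ≥0 → Ω → EuclideanSpace ℝ (Fin d)}
    (hB : IsBrownianMotion B P) (hB' : ∀ s, Measurable (B' s)) (hBB' : ∀ s, B s =ᵐ[P] B' s)
    {s u : ℝ≥0} (hsu : s ≠ u) (y : EuclideanSpace ℝ (Fin d)) :
    ∫⁻ ω, green (B' s ω - B' u ω) y ∂P ≤
      ENNReal.ofReal (meanGreenConst d * (√|(s : ℝ) - u|)⁻¹ ^ (d - 2)) := by
  have hcoord : ∀ i, Measurable fun ω => (B' s ω - B' u ω) i := fun i => by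
    have h1 := hB' s
    have h2 := hB' u
    fun_prop
  have hae : ∀ i, (fun ω => B s ω i - B u ω i) =ᵐ[P] fun ω => (B' s ω - B' u ω) i := fun i => by
    filter_upwards [hBB' s, hBB' u] with ω h1 h2
    rw [h1, h2]
    rfl
  have hne : nndist (s : ℝ) u ≠ 0 := by
    rw [Ne, nndist_eq_zero]
    exact fun h => hsu (NNReal.coe_injective h)
  have hpos : 0 < |(s : ℝ) - u| := abs_pos.2 (sub_ne_zero.2 fun h => hsu (NNReal.coe_injective h))
  refine WienerSausage.lintegral_green_le hd hcoord ?_ (by positivity) (fun i => ?_) y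
  · have := hB.indep.comp (fun _ w => w s - w u) fun _ =>
      (measurable_pi_apply s).sub (measurable_pi_apply u)
    exact this.congr hae
  · rw [← Measure.map_congr (hae i)]
    have h1 := ((hB.coord i).toIsPreBrownianReal.hasLaw_sub s u).map_eq
    have h2 : P.map (fun ω => B s ω i - B u ω i) ≤
        ENNReal.ofReal (√(nndist (s : ℝ) u : ℝ≥0))⁻¹ • volume :=
      h1.le.trans (gaussianReal_le_smul_volume 0 hne)
    rwa [coe_nndist, Real.dist_eq] at h2

/-- Continuity and measurability are given only almost surely, while joint measurability in time and
`ω` needs them everywhere. The path is set to zero off a measurable full-measure set on which it is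
continuous and agrees with measurable versions at a dense sequence of times; the other times follow
by limits. -/
theorem IsBrownianMotion.exists_measurable_continuous {d : ℕ} {Ω : Type*} [MeasurableSpace Ω]
    {P : Measure Ω} {B : ℝ≥0 → Ω → EuclideanSpace ℝ (Fin d)} (hB : IsBrownianMotion B P) :
    ∃ B' : ℝ≥0 → Ω → EuclideanSpace ℝ (Fin d), (∀ s, Measurable (B' s)) ∧
      (∀ ω, Continuous fun s => B' s ω) ∧ ∀ᵐ ω ∂P, ∀ s, B s ω = B' s ω := by
  have hmeas : ∀ s, AEMeasurable (B s) P := fun s => by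
    have h1 : AEMeasurable (fun ω i => B s ω i) P :=
      aemeasurable_pi_lambda _ fun i => (hB.coord i).toIsPreBrownianReal.aemeasurable s
    exact (measurable_toLp_fin d).comp_aemeasurable h1
  have hcont : ∀ᵐ ω ∂P, Continuous fun s => B s ω := by
    filter_upwards [ae_all_iff.2 fun i => (hB.coord i).cont] with ω hω
    exact (PiLp.continuous_toLp 2 (fun _ : Fin d => ℝ)).comp (continuous_pi hω)
  let D : ℕ → ℝ≥0 := TopologicalSpace.denseSeq ℝ≥0
  have hmk : ∀ᵐ ω ∂P, ∀ n, B (D n) ω = (hmeas (D n)).mk _ ω :=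
    ae_all_iff.2 fun n => (hmeas (D n)).ae_eq_mk
  obtain ⟨S, hS, hSm, hSP⟩ := (hcont.and hmk).exists_measurable_mem
  refine ⟨fun s => S.indicator (B s), ?_, ?_, ?_⟩
  · have hD : ∀ n, Measurable (S.indicator (B (D n))) := fun n => by
      rw [show S.indicator (B (D n)) = S.indicator ((hmeas (D n)).mk _) from
        Set.indicator_congr fun ω hω => (hSP ω hω).2 n]
      exact (hmeas (D n)).measurable_mk.indicator hSm
    intro s
    obtain ⟨x, hx, hxs⟩ := mem_closure_iff_seq_limit.1 (TopologicalSpace.denseRange_denseSeq ℝ≥0 s)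
    refine measurable_of_tendsto_metrizable (f := fun k => S.indicator (B (x k))) (fun k => ?_) ?_
    · obtain ⟨n, hn⟩ := hx k
      rw [← hn]
      exact hD n
    · refine tendsto_pi_nhds.2 fun ω => ?_
      by_cases h : ω ∈ S
      · simpa [h, Function.comp_def] using ((hSP ω h).1.tendsto s).comp hxs
      · simp [h]
  · intro ω
    by_cases h : ω ∈ S
    · simpa [h] using (hSP ω h).1
    · simpa [h] using continuous_const
  · filter_upwards [hS] with ω h s
    simp [h]

/-! ### The smoothed occupation measure as a test measure for the capacity -/

/-- The uniform probability measure on the time interval `[0, t]`. -/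
noncomputable def unifTime (t : ℝ) : Measure ℝ :=
  ENNReal.ofReal t⁻¹ • volume.restrict (Set.Icc 0 t)

instance {t : ℝ} : IsFiniteMeasure (unifTime t) := ⟨by
  rw [unifTime, Measure.smul_apply, Measure.restrict_apply_univ, Real.volume_Icc]
  exact ENNReal.mul_lt_top ENNReal.ofReal_lt_top ENNReal.ofReal_lt_top⟩

theorem isProbabilityMeasure_unifTime {t : ℝ} (ht : 0 < t) :
    IsProbabilityMeasure (unifTime t) := ⟨by
  rw [unifTime, Measure.smul_apply, Measure.restrict_apply_univ, Real.volume_Icc, smul_eq_mul,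
    ← ENNReal.ofReal_mul (by positivity), sub_zero, inv_mul_cancel₀ (by positivity),
    ENNReal.ofReal_one]⟩

/-- The law of `f s + q`, where `s` is uniform on `[0, t]` and `q` is uniform on a centred cube
contained in the ball of radius `r`. -/
noncomputable def smoothedOccupation {d : ℕ} (f : ℝ≥0 → EuclideanSpace ℝ (Fin d)) (r t : ℝ) :
    Measure (EuclideanSpace ℝ (Fin d)) :=
  ((unifTime t).prod (unifCube d (r / d))).map fun p => f p.1.toNNReal + p.2

theorem measurable_add_toNNReal {d : ℕ} {f : ℝ≥0 → EuclideanSpace ℝ (Fin d)} (hf : Continuous f) :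
    Measurable fun p : ℝ × EuclideanSpace ℝ (Fin d) => f p.1.toNNReal + p.2 :=
  (hf.measurable.comp (measurable_real_toNNReal.comp measurable_fst)).add measurable_snd

/-- The test measure is admissible: almost surely `s` lies in `[0, t]` and `‖q‖ < r`, so `B s + q`
lies in the sausage. -/
theorem inv_energy_le_cap {d : ℕ} (hd : 2 ≤ d) {Ω : Type*}
    (B : ℝ≥0 → Ω → EuclideanSpace ℝ (Fin d)) {r : ℝ} {t : ℝ≥0} (hr : 0 < r) (ht : 0 < t) (ω : Ω)
    (hB : Continuous fun s => B s ω) :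
    (energy (smoothedOccupation (fun s => B s ω) r t))⁻¹ ≤ cap (sausage B r t ω) := by
  have hd' : (2 : ℝ) ≤ d := by exact_mod_cast hd
  have hQ := isProbabilityMeasure_unifCube (d := d) (ρ := r / d) (by positivity)
  have hT := isProbabilityMeasure_unifTime (t := t) (by exact_mod_cast ht)
  have hm := measurable_add_toNNReal hB
  have hopen : IsOpen (sausage B r t ω) := isOpen_biUnion fun s _ => Metric.isOpen_ball
  refine ENNReal.inv_le_inv.2 (iInf_le_of_le _ (iInf_le_of_le
    (Measure.isProbabilityMeasure_map hm.aemeasurable) (iInf_le_of_le ?_ le_rfl)))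
  have h0 : ∀ᵐ s ∂(volume.restrict (Set.Icc 0 (t : ℝ))), s ∈ Set.Icc 0 (t : ℝ) :=
    ae_restrict_mem measurableSet_Icc
  have h1 : ∀ᵐ s ∂(unifTime t), s ∈ Set.Icc 0 (t : ℝ) := Measure.ae_smul_measure h0 _
  have h2 := ae_norm_lt_unifCube hd hr
  have h3 : ∀ᵐ p ∂((unifTime t).prod (unifCube d (r / d))), p.1 ∈ Set.Icc 0 (t : ℝ) :=
    Measure.quasiMeasurePreserving_fst.ae h1
  have h4 : ∀ᵐ p ∂((unifTime t).prod (unifCube d (r / d))), ‖p.2‖ < r :=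
    Measure.quasiMeasurePreserving_snd.ae h2
  have h5 : ∀ᵐ x ∂(smoothedOccupation (fun s => B s ω) r t), x ∈ sausage B r t ω := by
    refine (ae_map_iff hm.aemeasurable hopen.measurableSet).2 ?_
    filter_upwards [h3, h4] with p hp hq
    refine Set.mem_biUnion (x := p.1.toNNReal) ⟨zero_le, Real.toNNReal_le_iff_le_coe.2 hp.2⟩ ?_
    simpa [Metric.mem_ball, dist_eq_norm] using hq
  exact ae_iff.1 h5

theorem energy_smoothedOccupation {d : ℕ} {f : ℝ≥0 → EuclideanSpace ℝ (Fin d)} (hf : Continuous f)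
    {r t : ℝ} (hQ : IsProbabilityMeasure (unifCube d (r / d))) :
    energy (smoothedOccupation f r t) =
      ∫⁻ p : ℝ × EuclideanSpace ℝ (Fin d), ∫⁻ p' : ℝ × EuclideanSpace ℝ (Fin d),
        green (f p.1.toNNReal + p.2) (f p'.1.toNNReal + p'.2)
        ∂((unifTime t).prod (unifCube d (r / d))) ∂((unifTime t).prod (unifCube d (r / d))) := by
  have hm := measurable_add_toNNReal hf
  have hfin : IsFiniteMeasure (smoothedOccupation f r t) := by
    unfold smoothedOccupation; infer_instance
  have h1 : Measurable fun x => ∫⁻ y, green x y ∂(smoothedOccupation f r t) :=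
    (measurable_green measurable_fst measurable_snd).lintegral_prod_right'
  rw [energy]
  conv_lhs => rw [smoothedOccupation]
  rw [lintegral_map (by exact h1) hm]
  refine lintegral_congr fun p => ?_
  have h2 : Measurable fun y => green (f p.1.toNNReal + p.2) y :=
    measurable_green measurable_const measurable_id
  rw [lintegral_map h2 hm]

theorem confined_eq {d : ℕ} [NeZero d] {Ω : Type*} {B : ℝ≥0 → Ω → EuclideanSpace ℝ (Fin d)} {b r : ℝ}
    {t : ℝ≥0} (hr : 0 < r) :
    confined B b r t = {ω | ∀ s ≤ t, ‖B s ω‖ + r ≤ b * √(t : ℝ)} := by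
  ext ω
  simp only [confined, sausage, Set.mem_ofPred_eq, Set.iUnion₂_subset_iff,
    ball_subset_ball_zero_iff hr, Set.mem_Icc, zero_le, true_and]

/-! ### Mean energy and the resulting lower bound -/

section MeanEnergy

variable {d : ℕ} {Ω : Type*} [MeasurableSpace Ω] {P : Measure Ω} [IsProbabilityMeasure P]
  {B B' : ℝ≥0 → Ω → EuclideanSpace ℝ (Fin d)}

theorem measurable_path_comp (hB' : ∀ s, Measurable (B' s))
    (hcont : ∀ ω, Continuous fun s => B' s ω) {α : Type*} [MeasurableSpace α] {τ : α → ℝ} {w : α → Ω}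
    (hτ : Measurable τ) (hw : Measurable w) : Measurable fun x => B' (τ x).toNNReal (w x) :=
  (measurable_uncurry_of_continuous_of_measurable hcont hB').comp (hτ.real_toNNReal.prodMk hw)

theorem measurable_green_path (hB' : ∀ s, Measurable (B' s))
    (hcont : ∀ ω, Continuous fun s => B' s ω) {α : Type*} [MeasurableSpace α]
    {p q : α → ℝ × EuclideanSpace ℝ (Fin d)} {w : α → Ω} (hp : Measurable p) (hq : Measurable q)
    (hw : Measurable w) :
    Measurable fun x =>
      green (B' (p x).1.toNNReal (w x) + (p x).2) (B' (q x).1.toNNReal (w x) + (q x).2) :=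
  measurable_green ((measurable_path_comp hB' hcont hp.fst hw).add hp.snd)
    ((measurable_path_comp hB' hcont hq.fst hw).add hq.snd)

theorem measurable_energy_smoothedOccupation (hB' : ∀ s, Measurable (B' s))
    (hcont : ∀ ω, Continuous fun s => B' s ω) {r t : ℝ}
    (hQ : IsProbabilityMeasure (unifCube d (r / d))) :
    Measurable fun ω => energy (smoothedOccupation (fun s => B' s ω) r t) := by
  simp_rw [fun ω => energy_smoothedOccupation (hcont ω) (t := t) hQ]
  have hF : Measurable fun x : (Ω × ℝ × EuclideanSpace ℝ (Fin d)) × ℝ × EuclideanSpace ℝ (Fin d) =>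
      green (B' x.1.2.1.toNNReal x.1.1 + x.1.2.2) (B' x.2.1.toNNReal x.1.1 + x.2.2) :=
    measurable_green_path hB' hcont measurable_fst.snd measurable_snd measurable_fst.fst
  exact hF.lintegral_prod_right'.lintegral_prod_right'

/-- Two sources of randomness can remove the singularity. For times within `r ^ 2` of each other the
path is frozen and the cube variable `q` is averaged; for more distant times `q` is frozen and the
increment is averaged. -/
theorem IsBrownianMotion.lintegral_lintegral_green_le (hd : 3 ≤ d) (hB : IsBrownianMotion B P)
    (hB' : ∀ s, Measurable (B' s)) (hBB' : ∀ s, B s =ᵐ[P] B' s) {r : ℝ} (hr : 0 < r) (s u : ℝ≥0)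
    (p : EuclideanSpace ℝ (Fin d)) :
    ∫⁻ q, ∫⁻ ω, green (B' s ω + p) (B' u ω + q) ∂P ∂(unifCube d (r / d)) ≤
      ENNReal.ofReal (meanGreenConst d * d ^ (d - 2)) * ENNReal.ofReal
        (if |(s : ℝ) - u| ≤ r ^ 2 then r⁻¹ ^ (d - 2) else (√|(s : ℝ) - u|)⁻¹ ^ (d - 2)) := by
  have hd' : (3 : ℝ) ≤ d := by exact_mod_cast hd
  have hK := meanGreenConst_pos hd
  have hQ := isProbabilityMeasure_unifCube (d := d) (ρ := r / d) (by positivity)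
  rw [← ENNReal.ofReal_mul (by positivity)]
  split_ifs with h
  · rw [lintegral_lintegral_swap]
    · calc _ ≤ ∫⁻ _ω, ENNReal.ofReal (meanGreenConst d * (d * r⁻¹) ^ (d - 2)) ∂P := by
            refine lintegral_mono fun ω => ?_
            refine le_of_eq_of_le (lintegral_congr fun q => ?_)
              (lintegral_green_unifCube_le hd hr (B' s ω - B' u ω + p))
            simp only [green, edist_dist, dist_eq_norm]
            rw [← norm_neg]
            congr 4
            abel
        _ = _ := by
            rw [lintegral_const, measure_univ, mul_one, mul_pow, mul_assoc]
    · exact (measurable_green (((hB' s).comp measurable_snd).add_const p)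
        (((hB' u).comp measurable_snd).add measurable_fst)).aemeasurable
  · have hsu : s ≠ u := by
      rintro rfl
      exact h (by simpa using by positivity)
    calc _ ≤ ∫⁻ _q, ENNReal.ofReal (meanGreenConst d * (√|(s : ℝ) - u|)⁻¹ ^ (d - 2))
            ∂(unifCube d (r / d)) := by
          refine lintegral_mono fun q => ?_
          simp_rw [green_add_add]
          exact hB.lintegral_green_le hd hB' hBB' hsu _
      _ ≤ _ := by
          rw [lintegral_const, measure_univ, mul_one]
          refine ENNReal.ofReal_le_ofReal (mul_le_mul_of_nonneg_right ?_ (by positivity))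
          -- The factor `d ^ (d - 2)`, needed only in the short-time case, is given away here so
          -- that both cases share one constant.
          exact le_mul_of_one_le_right hK.le (one_le_pow₀ (by linarith))

/-- By Tonelli the mean energy is a double time average. For every outer time the inner average is
bounded uniformly, so only one factor `t⁻¹` survives. -/
theorem IsBrownianMotion.lintegral_energy_le (hd : 3 ≤ d) (hB : IsBrownianMotion B P)
    (hB' : ∀ s, Measurable (B' s)) (hcont : ∀ ω, Continuous fun s => B' s ω)
    (hBB' : ∀ s, B s =ᵐ[P] B' s) {r t : ℝ} (hr : 0 < r) (ht : 0 < t) :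
    ∫⁻ ω, energy (smoothedOccupation (fun s => B' s ω) r t) ∂P ≤
      ENNReal.ofReal t⁻¹ * (2 * (ENNReal.ofReal (meanGreenConst d * d ^ (d - 2)) *
        ∫⁻ v in Set.Icc 0 t,
          ENNReal.ofReal (if v ≤ r ^ 2 then r⁻¹ ^ (d - 2) else (√v)⁻¹ ^ (d - 2)))) := by
  have hd' : (3 : ℝ) ≤ d := by exact_mod_cast hd
  have hQ := isProbabilityMeasure_unifCube (d := d) (ρ := r / d) (by positivity)
  have hT := isProbabilityMeasure_unifTime ht
  have hF : Measurable fun x : (Ω × ℝ × EuclideanSpace ℝ (Fin d)) × ℝ × EuclideanSpace ℝ (Fin d) =>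
      green (B' x.1.2.1.toNNReal x.1.1 + x.1.2.2) (B' x.2.1.toNNReal x.1.1 + x.2.2) :=
    measurable_green_path hB' hcont measurable_fst.snd measurable_snd measurable_fst.fst
  set K := ENNReal.ofReal (meanGreenConst d * d ^ (d - 2)) with hK
  have hKt : K ≠ ⊤ := ENNReal.ofReal_ne_top
  set h : ℝ → ℝ≥0∞ :=
    fun v => ENNReal.ofReal (if v ≤ r ^ 2 then r⁻¹ ^ (d - 2) else (√v)⁻¹ ^ (d - 2)) with hh
  set μ := (unifTime t).prod (unifCube d (r / d)) with hμ
  have h0 : ∀ᵐ s ∂(volume.restrict (Set.Icc 0 t)), s ∈ Set.Icc 0 t :=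
    ae_restrict_mem measurableSet_Icc
  have h1 : ∀ᵐ s ∂(unifTime t), s ∈ Set.Icc 0 t := Measure.ae_smul_measure h0 _
  have h2 : ∀ᵐ p ∂μ, p.1 ∈ Set.Icc 0 t := Measure.quasiMeasurePreserving_fst.ae h1
  simp_rw [fun ω => energy_smoothedOccupation (hcont ω) (t := t) hQ]
  rw [lintegral_lintegral_swap hF.lintegral_prod_right'.aemeasurable]
  have key : ∀ᵐ p ∂μ, ∫⁻ ω, ∫⁻ p', green (B' p.1.toNNReal ω + p.2) (B' p'.1.toNNReal ω + p'.2) ∂μ ∂P ≤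
      ENNReal.ofReal t⁻¹ * (2 * (K * ∫⁻ v in Set.Icc 0 t, h v)) := by
    filter_upwards [h2] with p hp
    have hFp : Measurable fun x : Ω × ℝ × EuclideanSpace ℝ (Fin d) =>
        green (B' p.1.toNNReal x.1 + p.2) (B' x.2.1.toNNReal x.1 + x.2.2) :=
      measurable_green_path hB' hcont measurable_const measurable_snd measurable_fst
    rw [lintegral_lintegral_swap hFp.aemeasurable, hμ, lintegral_prod]
    · calc _ ≤ ∫⁻ u, K * h |p.1 - u| ∂(unifTime t) := by
            refine lintegral_mono_ae (h1.mono fun u hu => ?_)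
            have := hB.lintegral_lintegral_green_le hd hB' hBB' hr p.1.toNNReal u.toNNReal p.2
            rwa [Real.coe_toNNReal _ hp.1, Real.coe_toNNReal _ hu.1] at this
        _ = ENNReal.ofReal t⁻¹ * (K * ∫⁻ u in Set.Icc 0 t, h |p.1 - u|) := by
            rw [unifTime, lintegral_smul_measure, lintegral_const_mul' _ _ hKt, smul_eq_mul]
        _ ≤ _ := by
            rw [mul_left_comm 2]
            gcongr
            exact lintegral_Icc_abs_sub_le p.1 hp
    · have : Measurable fun x : (ℝ × EuclideanSpace ℝ (Fin d)) × Ω =>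
          green (B' p.1.toNNReal x.2 + p.2) (B' x.1.1.toNNReal x.2 + x.1.2) :=
        measurable_green_path hB' hcont measurable_const measurable_fst measurable_snd
      exact this.lintegral_prod_right'.aemeasurable
  refine (lintegral_mono_ae key).trans ?_
  rw [lintegral_const, measure_univ, mul_one]

theorem measurableSet_confined [NeZero d] {b r : ℝ} {t : ℝ≥0} (hr : 0 < r)
    (hB' : ∀ s, Measurable (B' s)) (hcont : ∀ ω, Continuous fun s => B' s ω) :
    MeasurableSet (confined B' b r t) := by
  -- By continuity a dense set of times decides the closed condition; clamping by `min` keeps those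
  -- times in `[0, t]` without losing density.
  have : confined B' b r t = ⋂ n, {ω |
      ‖B' (min (TopologicalSpace.denseSeq ℝ≥0 n) t) ω‖ + r ≤ b * √(t : ℝ)} := by
    rw [confined_eq hr]
    ext ω
    simp only [Set.mem_ofPred_eq, Set.mem_iInter]
    refine ⟨fun h n => h _ (min_le_right _ _), fun h s hs => ?_⟩
    have hcl : IsClosed {s : ℝ≥0 | ‖B' (min s t) ω‖ + r ≤ b * √(t : ℝ)} :=
      isClosed_le ((((hcont ω).comp (continuous_id.min continuous_const)).norm).add
        continuous_const) continuous_const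
    have := hcl.closure_subset_iff.2 (Set.range_subset_iff.2 h)
      (TopologicalSpace.denseRange_denseSeq ℝ≥0 s)
    simpa [min_eq_left hs] using this
  rw [this]
  exact MeasurableSet.iInter fun n => measurableSet_le ((hB' _).norm.add_const _) measurable_const

/-- The parameter `I` stands for the contribution of time gaps above `r ^ 2`, logarithmic or a
power, so one argument covers both regimes of dimension. -/
theorem IsBrownianMotion.le_confinedMeanCap (hd : 3 ≤ d) (hB : IsBrownianMotion B P) {b r I : ℝ}
    {t : ℝ≥0} (hr : 0 < r) (ht : 0 < t) (hI : 0 ≤ I)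
    (hlog : d = 4 → r ^ 2 ≤ t ∧ I = Real.log (t / r ^ 2))
    (hpow : d ≠ 4 → 5 ≤ d ∧ I = 2 / r ^ (d - 4)) :
    ENNReal.ofReal ((t : ℝ)⁻¹ * (2 * (meanGreenConst d * d ^ (d - 2) *
        (r ^ 2 * r⁻¹ ^ (d - 2) + I))))⁻¹ * P (confined B b r t) ^ 2 ≤
      confinedMeanCap B P b r t := by
  have hd' : (3 : ℝ) ≤ d := by exact_mod_cast hd
  have : NeZero d := ⟨by omega⟩
  have hK := meanGreenConst_pos hd
  have hQ := isProbabilityMeasure_unifCube (d := d) (ρ := r / d) (by positivity)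
  have ht' : (0 : ℝ) < t := by exact_mod_cast ht
  obtain ⟨B', hB', hcont, hBB'⟩ := hB.exists_measurable_continuous
  have hsau : ∀ᵐ ω ∂P, sausage B r t ω = sausage B' r t ω := by
    filter_upwards [hBB'] with ω hω
    simp only [sausage, hω]
  have hconf : confined B b r t =ᵐ[P] confined B' b r t := by
    filter_upwards [hsau] with ω hω
    refine propext ?_
    change sausage B r t ω ⊆ _ ↔ sausage B' r t ω ⊆ _
    rw [hω]
  have hmean := hB.lintegral_energy_le hd hB' hcont
    (fun s => hBB'.mono fun ω h => h s) hr ht'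
  have hI' := lintegral_bound_integral (n := d - 2) (t := t) hr hI (fun h => hlog (by omega))
    (fun h => by
      obtain ⟨h1, h2⟩ := hpow (by omega)
      exact ⟨by omega, h2⟩)
  have hle : ∫⁻ ω, energy (smoothedOccupation (fun s => B' s ω) r t) ∂P ≤
      ENNReal.ofReal ((t : ℝ)⁻¹ * (2 * (meanGreenConst d * d ^ (d - 2) *
        (r ^ 2 * r⁻¹ ^ (d - 2) + I)))) := by
    rw [ENNReal.ofReal_mul (by positivity), ENNReal.ofReal_mul (by positivity),
      ENNReal.ofReal_mul (by positivity), ENNReal.ofReal_ofNat]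
    exact hmean.trans (by gcongr)
  rw [measure_congr hconf]
  refine (sq_measure_div_le (confined B' b r t)
    (measurable_energy_smoothedOccupation hB' hcont hQ) (by positivity) hle).trans ?_
  rw [confinedMeanCap, ← lintegral_indicator (measurableSet_confined hr hB' hcont)]
  refine lintegral_mono_ae ?_
  filter_upwards [hsau] with ω hω
  have hmem : ω ∈ confined B b r t ↔ ω ∈ confined B' b r t := by
    simp only [confined, Set.mem_ofPred_eq, hω]
  by_cases h : ω ∈ confined B' b r t
  · rw [Set.indicator_of_mem h, Set.indicator_of_mem (hmem.2 h), hω]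
    exact inv_energy_le_cap (by omega) B' hr ht ω (hcont ω)
  · rw [Set.indicator_of_notMem h]
    exact zero_le

end MeanEnergy

end WienerSausage

/-! ### Explicit constants in the two regimes -/

theorem mainTheorem3 (d : ℕ) :
    (5 ≤ d → ∃ c : ℝ, 0 < c ∧
      ∀ (Ω : Type*) [MeasurableSpace Ω] (P : Measure Ω) [IsProbabilityMeasure P]
        (B : ℝ≥0 → Ω → EuclideanSpace ℝ (Fin d)), WienerSausage.IsBrownianMotion B P →
      ∀ (b : ℝ) (t : ℝ≥0) (r : ℝ), 0 < b → 1 ≤ t → 0 < r → r < 1 →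
        ENNReal.ofReal (c * ((t : ℝ) * r ^ (d - 4))) * P (WienerSausage.confined B b r t) ^ 2 ≤
          WienerSausage.confinedMeanCap B P b r t) ∧
    (d = 4 → ∀ s₀ : ℝ, 1 < s₀ → ∃ c : ℝ, 0 < c ∧
      ∀ (Ω : Type*) [MeasurableSpace Ω] (P : Measure Ω) [IsProbabilityMeasure P]
        (B : ℝ≥0 → Ω → EuclideanSpace ℝ (Fin d)), WienerSausage.IsBrownianMotion B P →
      ∀ (b : ℝ) (t : ℝ≥0) (r : ℝ), 0 < b → 1 ≤ t → 0 < r → r < 1 → s₀ ≤ (t : ℝ) / r ^ 2 →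
        ENNReal.ofReal (c * ((t : ℝ) / Real.log ((t : ℝ) / r ^ 2))) *
            P (WienerSausage.confined B b r t) ^ 2 ≤
          WienerSausage.confinedMeanCap B P b r t) := by
  refine ⟨fun hd => ?_, fun hd s₀ hs₀ => ?_⟩
  · have hK := WienerSausage.meanGreenConst_pos (d := d) (by omega)
    have hd' : (5 : ℝ) ≤ d := by exact_mod_cast hd
    -- The short gaps contribute `r ^ (4 - d)` and the long ones at most `2 * r ^ (4 - d)`; the
    -- factor `2` from the two sides of `s` makes `6`.
    refine ⟨(6 * (WienerSausage.meanGreenConst d * d ^ (d - 2)))⁻¹, by positivity, ?_⟩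
    intro Ω _ P _ B hB b t r _ ht hr _
    have ht0 : 0 < t := zero_lt_one.trans_le ht
    have ht' : (0 : ℝ) < t := by exact_mod_cast ht0
    refine le_of_eq_of_le ?_ (hB.le_confinedMeanCap (by omega) hr ht0
      (I := 2 / r ^ (d - 4)) (by positivity) (fun h => absurd h (by omega)) fun _ => ⟨hd, rfl⟩)
    congr 2
    obtain ⟨n, rfl⟩ : ∃ n, d = n + 4 := ⟨d - 4, by omega⟩
    rw [show n + 4 - 2 = n + 2 by omega, show n + 4 - 4 = n by omega]
    have hr2 : r ^ 2 * r⁻¹ ^ (n + 2) = (r ^ n)⁻¹ := by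
      rw [inv_pow, pow_add]
      field_simp
    rw [hr2]
    field_simp
    norm_num
  · subst hd
    have hK := WienerSausage.meanGreenConst_pos (d := 4) (by omega)
    have hlog₀ := Real.log_pos hs₀
    -- In dimension four the short gaps contribute `1`. Since `log (t / r ^ 2) ≥ log s₀ > 0`, this
    -- `1` is absorbed into `log (t / r ^ 2) / log s₀`.
    refine ⟨(2 * (WienerSausage.meanGreenConst 4 * ((4 : ℕ) : ℝ) ^ (4 - 2)) *
      (1 / Real.log s₀ + 1))⁻¹, by positivity, ?_⟩
    intro Ω _ P _ B hB b t r _ ht hr hr1 hts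
    have ht0 : 0 < t := zero_lt_one.trans_le ht
    have ht1 : (1 : ℝ) ≤ t := by exact_mod_cast ht
    have hlog : Real.log s₀ ≤ Real.log (t / r ^ 2) := Real.log_le_log (by linarith) hts
    have hlog' := hlog₀.trans_le hlog
    refine le_trans (mul_le_mul_left (ENNReal.ofReal_le_ofReal ?_) _) (hB.le_confinedMeanCap
      (by omega) hr ht0 (I := Real.log (t / r ^ 2)) hlog'.le
      (fun _ => ⟨(pow_le_one₀ hr.le hr1.le).trans ht1, rfl⟩) fun h => absurd rfl h)
    rw [← inv_div _ (t : ℝ), ← mul_inv]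
    refine inv_anti₀ (by positivity) ?_
    have h1 : r ^ 2 * r⁻¹ ^ (4 - 2) = 1 := by
      rw [← mul_pow, mul_inv_cancel₀ hr.ne', one_pow]
    have h2 : 1 ≤ 1 / Real.log s₀ * Real.log (t / r ^ 2) := by
      rw [one_div, ← div_eq_inv_mul]
      exact (one_le_div hlog₀).2 hlog
    rw [h1]
    calc _ ≤ (t : ℝ)⁻¹ * (2 * (WienerSausage.meanGreenConst 4 * ((4 : ℕ) : ℝ) ^ (4 - 2) *
          (1 / Real.log s₀ * Real.log (t / r ^ 2) + Real.log (t / r ^ 2)))) := by gcongr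
      _ = _ := by
        field_simp
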